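/- Consider a two-party Bell scenario with $m_A$ inputs for Alice, $m_B$ inputs for Bob, $d_{A,i_A}$ outputs for Alice's input $i_A$ and $d_{B,i_B}$ outputs for Bob's input $i_B$, where all these numbers are arbitrary. A box is a vector $P=(P(o_A,o_B|i_A,i_B))\in\mathbb R^n$ with $n=\left(\sum_{i_A}d_{A,i_A}\right)\left(\sum_{i_B}d_{B,i_B}\right)$. The no-signalling polytope $\mathbf{NS}$ is the set of boxes that are non-negative, normalized ($\sum_{o_A,o_B}P(o_A,o_B|i_A,i_B)=1$ for all $i_A,i_B$) and no-signalling ($\sum_{o_A}P(o_A,o_B|i_A,i_B)$ does not depend on $i_A$ and $\sum_{o_B}P(o_A,o_B|i_A,i_B)$ does not depend on $i_B$). The classical polytope $\mathbf C$ is the convex hull of the boxes in $\mathbf{NS}$ with all entries in $\{0,1\}$. The almost quantum set $\mathbf Q_{1+AB}$ is the set of boxes $P\in\mathbf{NS}$ for which there is a complex Hermitian positive semidefinite matrix $\Gamma$, with rows and columns indexed by the formal operators $\mathbb 1$ and $E^A_{i_A,o_A}E^B_{i_B,o_B}$ (for all $i_A,o_A,i_B,o_B$), such that $\Gamma_{\mathbb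 1,\mathbb 1}=1$, $\Gamma_{\mathbb 1,E^A_{i_A,o_A}E^B_{i_B,o_B}}=P(o_A,o_B|i_A,i_B)$, $\Gamma_{Q,R}=\Gamma_{S,T}$ whenever $Q^\dagger R=S^\dagger T$, and $\Gamma_{Q,R}=0$ whenever $Q^\dagger R=0$. Here the products are reduced by the rules that the $E^A_{i_A,o_A}$ and $E^B_{i_B,o_B}$ are Hermitian idempotents, that those of the same party with the same input and different outputs have product $0$, and that those of different parties commute. For a polytope $K$, an inequality $\sum_{o_A,o_B,i_A,i_B} B(o_A,o_B,i_A,i_B)P(o_A,o_B|i_A,i_B)\le\omega$ supports a facet of $K$ if it holds for all $P\in K$ and the set of $P\in K$ that attain equality is non-empty, different from $K$, and has dimension $\dim K-1$. A facet Bell inequality is an inequality that supports a facet of $\mathbf C$ and does not support a facet of $\mathbf{NS}$ (this excludes the trivial facets such as $P(o_A,o_B|i_A,i_B)\ge 0$). **Theorem.** In every two-party Bell scenario, irrespective of the numbers of inputs and outputs, every facet Bell inequality $$\sum_{o_A,o_B,i_A,i_B} q(i_A,i_B)\,V(o_A,o_B,i_A,i_B)\,P(o_A,o_B|i_A,i_B)\le\omega_c$$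 (with arbitrary real $q$ and $V$) is violated by almost quantum correlations. That is, $\omega_c$ is the maximum of the left-hand side over $\mathbf C$ (the classical value), the supremum $\omega_{\tilde q}$ of the left-hand side over $\mathbf Q_{1+AB}$ (the almost quantum value) is finite, and $\omega_{\tilde q}>\omega_c$. -/

import Mathlib

open scoped ComplexOrder

/-! Two-party Bell scenarios, their classical, no-signalling and almost quantum sets.

A scenario is given by numbers of inputs `mA mB : ℕ` and, for each input, a number of outputs
`dA : Fin mA → ℕ`, `dB : Fin mB → ℕ`. -/

/-- A pair (input, output) of one party; it labels the projector `E_{input, output}`. -/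
abbrev LocalEvent {m : ℕ} (d : Fin m → ℕ) : Type := Σ i : Fin m, Fin (d i)

/-- An event `(o_A, o_B | i_A, i_B)`, written `(⟨i_A, o_A⟩, ⟨i_B, o_B⟩)`. -/
abbrev BellEvent {mA mB : ℕ} (dA : Fin mA → ℕ) (dB : Fin mB → ℕ) : Type :=
  LocalEvent dA × LocalEvent dB

/-- Boxes: vectors `P` in `ℝ^n` with entries `P(o_A, o_B | i_A, i_B)`. -/
abbrev Box {mA mB : ℕ} (dA : Fin mA → ℕ) (dB : Fin mB → ℕ) : Type := BellEvent dA dB → ℝ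

/-- The no-signalling polytope: non-negative, normalized, no-signalling boxes. -/
structure IsNoSignalling {mA mB : ℕ} {dA : Fin mA → ℕ} {dB : Fin mB → ℕ}
    (P : Box dA dB) : Prop where
  nonneg : ∀ e, 0 ≤ P e
  normalized : ∀ (x : Fin mA) (y : Fin mB),
    ∑ a : Fin (dA x), ∑ b : Fin (dB y), P (⟨x, a⟩, ⟨y, b⟩) = 1
  noSignalling_to_Bob : ∀ (x x' : Fin mA) (y : Fin mB) (b : Fin (dB y)),
    ∑ a : Fin (dA x), P (⟨x, a⟩, ⟨y, b⟩) = ∑ a' : Fin (dA x'), P (⟨x', a'⟩, ⟨y, b⟩)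
  noSignalling_to_Alice : ∀ (y y' : Fin mB) (x : Fin mA) (a : Fin (dA x)),
    ∑ b : Fin (dB y), P (⟨x, a⟩, ⟨y, b⟩) = ∑ b' : Fin (dB y'), P (⟨x, a⟩, ⟨y', b'⟩)

def noSignallingPolytope {mA mB : ℕ} (dA : Fin mA → ℕ) (dB : Fin mB → ℕ) : Set (Box dA dB) :=
  {P | IsNoSignalling P}

/-- Local deterministic boxes: no-signalling boxes with entries in `{0, 1}`. -/
def localDeterministicBoxes {mA mB : ℕ} (dA : Fin mA → ℕ) (dB : Fin mB → ℕ) :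
    Set (Box dA dB) :=
  {P | IsNoSignalling P ∧ ∀ e, P e = 0 ∨ P e = 1}

/-- The classical (Bell, local) polytope. -/
def classicalPolytope {mA mB : ℕ} (dA : Fin mA → ℕ) (dB : Fin mB → ℕ) : Set (Box dA dB) :=
  convexHull ℝ (localDeterministicBoxes dA dB)

/-- The index set `{1} ∪ {E^A_{i_A,o_A} E^B_{i_B,o_B}}` of the level `1 + AB`;
`none` is the identity operator. -/
abbrev OpIndex {mA mB : ℕ} (dA : Fin mA → ℕ) (dB : Fin mB → ℕ) : Type :=
  Option (BellEvent dA dB)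

/-- Product of two operators of one party, each of which is the identity (`none`) or a projector
(`some u`). The result is `some w` for the reduced word `w` in the projectors (`[]` being the
identity), or `none` if the product is the zero operator, which happens for
different outputs of the same input. -/
def localProduct {m : ℕ} {d : Fin m → ℕ} :
    Option (LocalEvent d) → Option (LocalEvent d) → Option (List (LocalEvent d))
  | none, none => some []
  | none, some v => some [v]
  | some u, none => some [u]
  | some u, some v => if u = v then some [u] else if u.1 = v.1 then none else some [u, v]

/-- The operator `Q† R`. Since the projectors are Hermitian and those of different parties commute,
`(E^A E^B)† (E'^A E'^B) = (E^A E'^A) (E^B E'^B)`; it is recorded as the pair of reduced words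
of Alice and Bob, and as `none` if it is the zero operator. -/
def daggerProduct {mA mB : ℕ} {dA : Fin mA → ℕ} {dB : Fin mB → ℕ} (Q R : OpIndex dA dB) :
    Option (List (LocalEvent dA) × List (LocalEvent dB)) :=
  match localProduct (Q.map Prod.fst) (R.map Prod.fst),
      localProduct (Q.map Prod.snd) (R.map Prod.snd) with
  | some u, some v => some (u, v)
  | _, _ => none

/-- `Γ` is a certificate of level `1 + AB` for the box `P`. -/
structure IsCertificate {mA mB : ℕ} {dA : Fin mA → ℕ} {dB : Fin mB → ℕ}
    (Γ : Matrix (OpIndex dA dB) (OpIndex dA dB) ℂ) (P : Box dA dB) : Prop where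
  posSemidef : Γ.PosSemidef
  one_one : Γ none none = 1
  eq_of_product_eq : ∀ Q R S T, daggerProduct Q R = daggerProduct S T → Γ Q R = Γ S T
  eq_zero_of_product_eq_zero : ∀ Q R, daggerProduct Q R = none → Γ Q R = 0
  prob : ∀ e, Γ none (some e) = (P e : ℂ)

/-- The almost quantum set `Q_{1+AB}`. Completeness of the measurements enters through the
normalization and no-signalling of `P`. -/
def almostQuantumSet {mA mB : ℕ} (dA : Fin mA → ℕ) (dB : Fin mB → ℕ) : Set (Box dA dB) :=
  {P | IsNoSignalling P ∧ ∃ Γ, IsCertificate Γ P}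

/-- The Bell expression `∑ B(o_A,o_B,i_A,i_B) P(o_A,o_B|i_A,i_B)`. -/
def bellValue {mA mB : ℕ} {dA : Fin mA → ℕ} {dB : Fin mB → ℕ} (B P : Box dA dB) : ℝ :=
  ∑ e, B e * P e

/-- The dimension of (the affine hull of) a non-empty set of boxes. -/
noncomputable def affineDim {mA mB : ℕ} {dA : Fin mA → ℕ} {dB : Fin mB → ℕ}
    (K : Set (Box dA dB)) : ℕ :=
  Module.finrank ℝ (affineSpan ℝ K).direction

/-- The face of `K` supported by the inequality `B · P ≤ ω`. -/
def face {mA mB : ℕ} {dA : Fin mA → ℕ} {dB : Fin mB → ℕ} (K : Set (Box dA dB))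
    (B : Box dA dB) (ω : ℝ) : Set (Box dA dB) :=
  {P | P ∈ K ∧ bellValue B P = ω}

/-- The inequality `B · P ≤ ω` is valid on the polytope `K` and supports a facet of it, i.e. a
proper non-empty face of dimension `dim K - 1`. -/
structure SupportsFacet {mA mB : ℕ} {dA : Fin mA → ℕ} {dB : Fin mB → ℕ}
    (K : Set (Box dA dB)) (B : Box dA dB) (ω : ℝ) : Prop where
  valid : ∀ P ∈ K, bellValue B P ≤ ω
  nonempty : (face K B ω).Nonempty
  proper : face K B ω ≠ K
  dim : affineDim (face K B ω) + 1 = affineDim K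

/-- Facet (tight) Bell inequalities: facets of the classical polytope that are not also facets of
the no-signalling polytope. -/
structure IsFacetBellInequality {mA mB : ℕ} {dA : Fin mA → ℕ} {dB : Fin mB → ℕ}
    (B : Box dA dB) (ω : ℝ) : Prop where
  facet : SupportsFacet (classicalPolytope dA dB) B ω
  nontrivial : ¬ SupportsFacet (noSignallingPolytope dA dB) B ω

/-- `ω_c`, the maximum of the Bell expression over the classical polytope. -/
noncomputable def classicalValue {mA mB : ℕ} {dA : Fin mA → ℕ} {dB : Fin mB → ℕ}
    (B : Box dA dB) : ℝ :=
  sSup (bellValue B '' classicalPolytope dA dB)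

/-- `ω_q̃`, the maximum of the Bell expression over the almost quantum set. -/
noncomputable def almostQuantumValue {mA mB : ℕ} {dA : Fin mA → ℕ} {dB : Fin mB → ℕ}
    (B : Box dA dB) : ℝ :=
  sSup (bellValue B '' almostQuantumSet dA dB)

/-!
If a facet inequality `B · P ≤ ω` of the classical polytope is valid on the almost quantum set,
then it is valid, and hence supports a facet, on the no-signalling polytope as well.

Every no-signalling box is a signed mixture `∑ δ, c δ • P_δ` of deterministic boxes, so an
inequality is determined by its slacks `s δ = ω - B · P_δ`. A real positive semidefinite matrix
`Y` indexed by deterministic strategies yields the certificate `∑ δ δ', Y δ δ' * Q(δ) * R(δ')` of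
an almost quantum box, provided that these moments vanish on orthogonal projectors. Validity on the
almost quantum set therefore makes the functional `Y ↦ ∑ δ δ', Y δ δ' * s δ` non-negative on the
positive semidefinite matrices of a linear space, and M. Riesz's extension theorem turns it into
`Y ↦ tr (G Y)` for a positive semidefinite `G`. The boxes on the face force `G` to vanish on the
hyperplane orthogonal to `s`, so that `G` is a positive multiple of `s sᵀ`. Hence
`⟨v, s⟩ ⟨w, s⟩ = 0` whenever `v` and `w` are weights whose signed mixtures are orthogonal on
exclusive events and those of `w` add up to zero.

Testing this with differences of strategies that change the answers to two different inputs shows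
that `s` depends on a single input of one party and, once the answer to it is given, on a single
input of the other. Such a function is a non-negative combination of probabilities of events, so
`ω - B · P` is non-negative for every no-signalling box `P`.
-/

section LinearAlgebra

open Matrix

variable {ι : Type*} [Fintype ι]

/-- The cone of real matrices with non-negative quadratic form. No symmetry is required, so that
together with the multiples of `1` it exhausts all matrices. -/
def nonnegQuadraticForms (ι : Type*) [Fintype ι] : PointedCone ℝ (Matrix ι ι ℝ) where
  carrier := {Y | ∀ v, 0 ≤ v ⬝ᵥ Y *ᵥ v}
  add_mem' hY hZ v := by
    simpa only [add_mulVec, dotProduct_add] using add_nonneg (hY v) (hZ v)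
  zero_mem' v := by simp only [zero_mulVec, dotProduct_zero, le_refl]
  smul_mem' c Y hY v := by
    rw [show c • Y = (c : ℝ) • Y from rfl, smul_mulVec, dotProduct_smul]
    exact mul_nonneg c.2 (hY v)

lemma exists_smul_one_add_mem_nonnegQuadraticForms [DecidableEq ι] (Y : Matrix ι ι ℝ) :
    ∃ c : ℝ, c • 1 + Y ∈ nonnegQuadraticForms ι := by
  refine ⟨∑ i, ∑ j, |Y i j|, fun v => ?_⟩
  have hcoord (i : ι) : v i ^ 2 ≤ v ⬝ᵥ v := by
    simpa only [dotProduct, sq] using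
      Finset.single_le_sum (fun j _ => mul_self_nonneg (v j)) (Finset.mem_univ i)
  have hentry (i j : ι) : -(|Y i j| * (v ⬝ᵥ v)) ≤ v i * (Y i j * v j) := by
    have hvv : |v i * v j| ≤ v ⬝ᵥ v := by
      rw [abs_mul]
      nlinarith [hcoord i, hcoord j, sq_abs (v i), sq_abs (v j), sq_nonneg (|v i| - |v j|)]
    have := mul_le_mul_of_nonneg_left hvv (abs_nonneg (Y i j))
    rw [← abs_mul] at this
    linarith [neg_abs_le (Y i j * (v i * v j))]
  have hform : v ⬝ᵥ Y *ᵥ v = ∑ i, ∑ j, v i * (Y i j * v j) := by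
    simp only [dotProduct, mulVec, Finset.mul_sum]
  rw [add_mulVec, dotProduct_add, smul_mulVec, one_mulVec, dotProduct_smul, smul_eq_mul, hform]
  have := Finset.sum_le_sum fun i (_ : i ∈ Finset.univ) =>
    Finset.sum_le_sum fun j (_ : j ∈ Finset.univ) => hentry i j
  simp only [Finset.sum_neg_distrib, ← Finset.sum_mul] at this
  linarith

lemma posSemidef_add_transpose {Y : Matrix ι ι ℝ} (hY : Y ∈ nonnegQuadraticForms ι) :
    (Y + Yᵀ).PosSemidef := by
  refine .of_dotProduct_mulVec_nonneg ?_ fun v => ?_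
  · simpa only [conjTranspose_eq_transpose_of_trivial] using isHermitian_add_transpose_self Y
  · rw [star_trivial, add_mulVec, dotProduct_add, mulVec_transpose, dotProduct_comm v (v ᵥ* Y),
      ← dotProduct_mulVec]
    exact add_nonneg (hY v) (hY v)

lemma vecMulVec_self_mem_nonnegQuadraticForms (v : ι → ℝ) :
    vecMulVec v v ∈ nonnegQuadraticForms ι := fun w => by
  rw [vecMulVec_mulVec, op_smul_eq_smul, dotProduct_smul, dotProduct_comm w v]
  exact mul_self_nonneg _

lemma vecMulVec_sub_swap_mem_nonnegQuadraticForms (v w : ι → ℝ) :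
    vecMulVec v w - vecMulVec w v ∈ nonnegQuadraticForms ι := fun u => by
  rw [sub_mulVec, vecMulVec_mulVec, vecMulVec_mulVec, op_smul_eq_smul, op_smul_eq_smul,
    dotProduct_sub, dotProduct_smul, dotProduct_smul, dotProduct_comm u v, dotProduct_comm u w,
    smul_eq_mul, smul_eq_mul, mul_comm, sub_self]

/-- A positive functional on a transpose-invariant space of matrices extends, by M. Riesz's
theorem, to all matrices; its values on rank-one matrices form a positive semidefinite matrix. -/
theorem exists_posSemidef_extension [DecidableEq ι] {S : Submodule ℝ (Matrix ι ι ℝ)} (hone : 1 ∈ S)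
    (htranspose : ∀ Y ∈ S, Yᵀ ∈ S) (f : Matrix ι ι ℝ →ₗ[ℝ] ℝ) (hf : ∀ Y ∈ S, f Yᵀ = f Y)
    (hpos : ∀ Y ∈ S, Y.PosSemidef → 0 ≤ f Y) :
    ∃ G : Matrix ι ι ℝ, G.PosSemidef ∧
      ∀ v w, vecMulVec v w ∈ S → v ⬝ᵥ G *ᵥ w = f (vecMulVec v w) := by
  obtain ⟨g, hgS, hgpos⟩ := riesz_extension (nonnegQuadraticForms ι) ⟨S, f.domRestrict S⟩
    (fun Y hY => by
      have := hpos _ (S.add_mem Y.2 (htranspose _ Y.2)) (posSemidef_add_transpose hY)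
      rw [map_add, hf _ Y.2] at this
      change 0 ≤ f Y
      linarith)
    (fun Y => by
      obtain ⟨c, hc⟩ := exists_smul_one_add_mem_nonnegQuadraticForms Y
      exact ⟨⟨c • 1, S.smul_mem c hone⟩, hc⟩)
  have hsingle (i j : ι) (r : ℝ) : g (single i j r) = r * g (single i j 1) := by
    rw [← smul_eq_mul, ← map_smul, smul_single, smul_eq_mul, mul_one]
  have hg (v w : ι → ℝ) : v ⬝ᵥ of (fun i j => g (single i j 1)) *ᵥ w = g (vecMulVec v w) := by
    rw [matrix_eq_sum_single (vecMulVec v w)]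
    simp only [dotProduct, mulVec, of_apply, map_sum, Finset.mul_sum]
    refine Finset.sum_congr rfl fun i _ => Finset.sum_congr rfl fun j _ => ?_
    rw [hsingle i j (vecMulVec v w i j), vecMulVec_apply]
    ring
  have hsymm (v w : ι → ℝ) : g (vecMulVec v w) = g (vecMulVec w v) := by
    have h₁ := hgpos _ (vecMulVec_sub_swap_mem_nonnegQuadraticForms v w)
    have h₂ := hgpos _ (vecMulVec_sub_swap_mem_nonnegQuadraticForms w v)
    rw [map_sub] at h₁ h₂
    linarith
  refine ⟨of fun i j => g (single i j 1), .of_dotProduct_mulVec_nonneg ?_ fun v => ?_,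
    fun v w hvw => ?_⟩
  · ext i j
    rw [conjTranspose_apply, of_apply, of_apply, star_trivial, single_eq_single_vecMulVec_single,
      hsymm, single_eq_single_vecMulVec_single]
  · rw [star_trivial, hg]
    exact hgpos _ (vecMulVec_self_mem_nonnegQuadraticForms v)
  · rw [hg]
    exact hgS ⟨_, hvw⟩

lemma exists_eq_smul_vecMulVec {G : Matrix ι ι ℝ} (hG : G.IsSymm) {s : ι → ℝ}
    (hs : s ≠ 0) (hker : ∀ v, v ⬝ᵥ s = 0 → G *ᵥ v = 0) : ∃ c : ℝ, G = c • vecMulVec s s := by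
  classical
  have hss : s ⬝ᵥ s ≠ 0 := dotProduct_self_eq_zero.not.2 hs
  have hcol (i j : ι) : G i j = s j / (s ⬝ᵥ s) * (G *ᵥ s) i := by
    have horth : (Pi.single j 1 - (s j / (s ⬝ᵥ s)) • s) ⬝ᵥ s = 0 := by
      rw [sub_dotProduct, single_one_dotProduct, smul_dotProduct, smul_eq_mul,
        div_mul_cancel₀ _ hss, sub_self]
    have := congrFun (hker _ horth) i
    rwa [mulVec_sub, mulVec_smul, mulVec_single_one, Pi.sub_apply, Pi.zero_apply, sub_eq_zero]
      at this
  have hrow (i : ι) : (G *ᵥ s) i = s i / (s ⬝ᵥ s) * (s ⬝ᵥ G *ᵥ s) := by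
    calc (G *ᵥ s) i = ∑ j, G j i * s j := by
          simp only [mulVec, dotProduct, hG.apply i]
      _ = s i / (s ⬝ᵥ s) * (s ⬝ᵥ G *ᵥ s) := by
          simp only [hcol _ i, dotProduct, Finset.mul_sum]
          exact Finset.sum_congr rfl fun j _ => by ring
  refine ⟨(s ⬝ᵥ G *ᵥ s) / (s ⬝ᵥ s) ^ 2, ?_⟩
  ext i j
  rw [hcol, hrow, Matrix.smul_apply, vecMulVec_apply, smul_eq_mul]
  ring

lemma posSemidef_map_ofReal {ι 𝕜 : Type*} [Finite ι] [RCLike 𝕜] {M : Matrix ι ι ℝ}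
    (hM : M.PosSemidef) : (M.map ((↑) : ℝ → 𝕜)).PosSemidef := by
  obtain ⟨n, v, rfl⟩ := posSemidef_iff_eq_sum_vecMulVec.1 hM
  have hmap : (∑ k, vecMulVec (v k) (star (v k))).map ((↑) : ℝ → 𝕜) =
      ∑ k, vecMulVec (fun i => (v k i : 𝕜)) (star fun i => (v k i : 𝕜)) := by
    ext i j
    simp only [map_apply, Matrix.sum_apply, vecMulVec_apply, Pi.star_apply, star_trivial,
      RCLike.star_def, RCLike.conj_ofReal, map_sum, map_mul]
  rw [hmap]
  exact posSemidef_sum _ fun k _ => posSemidef_vecMulVec_self_star _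

end LinearAlgebra

section DependsOn

variable {ι κ : Type*} {π : ι → Type*} {ρ : κ → Type*}

lemma dependsOn_inter {X : Type*} {f : (∀ i, π i) → X} {s t : Set ι} (hs : DependsOn f s)
    (ht : DependsOn f t) : DependsOn f (s ∩ t) := by
  classical
  intro α β h
  trans f fun i => if i ∈ s then α i else β i
  · exact hs fun i hi => (if_pos hi).symm
  · exact ht fun i hi => ite_eq_right_iff.2 fun his => h i ⟨his, hi⟩

lemma dependsOn_compl_finset {X : Type*} {f : (∀ i, π i) → X} (s : Finset ι)
    (h : ∀ i ∈ s, DependsOn f {i}ᶜ) : DependsOn f (↑s)ᶜ := by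
  classical
  induction s using Finset.induction_on with
  | empty => simpa only [Finset.coe_empty, Set.compl_empty] using dependsOn_univ f
  | insert i s _ ih =>
    rw [Finset.coe_insert, Set.insert_eq, Set.compl_union]
    exact dependsOn_inter (h i (Finset.mem_insert_self i s))
      (ih fun j hj => h j (Finset.mem_insert_of_mem hj))

lemma dependsOn_singleton [Finite ι] {X : Type*} {f : (∀ i, π i) → X} {x : ι}
    (h : ∀ x' ≠ x, DependsOn f {x'}ᶜ) : DependsOn f {x} := by
  classical
  have := Fintype.ofFinite ι
  have := dependsOn_compl_finset {x}ᶜ fun x' hx' => h x' (by simpa using hx')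
  rwa [Finset.coe_compl, compl_compl, Finset.coe_singleton] at this

lemma exists_dependsOn_singleton [Finite ι] [Nonempty ι] {X : Type*} {f : (∀ i, π i) → X}
    (h : ∀ x x', x ≠ x' → DependsOn f {x}ᶜ ∨ DependsOn f {x'}ᶜ) : ∃ x, DependsOn f {x} := by
  by_cases hx : ∃ x, ¬ DependsOn f {x}ᶜ
  · obtain ⟨x, hx⟩ := hx
    exact ⟨x, dependsOn_singleton fun x' hx' => (h x x' hx'.symm).resolve_left hx⟩
  · push Not at hx
    exact ⟨Classical.arbitrary ι, dependsOn_singleton fun x' _ => hx x'⟩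

variable [DecidableEq ι]

lemma dependsOn_compl_singleton_iff {X : Type*} {f : (∀ i, π i) → X} {x : ι} :
    DependsOn f {x}ᶜ ↔ ∀ α a, f (Function.update α x a) = f α := by
  refine ⟨fun h α a => h fun i hi => Function.update_of_ne hi a α, fun h α β hαβ => ?_⟩
  rw [← h α (β x)]
  congr 1
  exact Function.update_eq_iff.2 ⟨rfl, fun i hi => hαβ i hi⟩

variable {M : Type*} [AddCommGroup M]

/-- The mixed differences of `f` in the coordinate `x` of its first and the coordinate `y` of its
second argument vanish. -/
def SeparatesAt (f : (∀ i, π i) → (∀ k, ρ k) → M) (x : ι) (y : κ) : Prop :=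
  ∀ α a, DependsOn (fun β => f (Function.update α x a) β - f α β) {y}ᶜ

lemma SeparatesAt.flip [DecidableEq κ] {f : (∀ i, π i) → (∀ k, ρ k) → M} {x : ι} {y : κ}
    (h : SeparatesAt f x y) : SeparatesAt (flip f) y x := fun β b =>
  dependsOn_compl_singleton_iff.2 fun α a =>
    sub_eq_sub_iff_sub_eq_sub.1 (dependsOn_compl_singleton_iff.1 (h α a) β b)

lemma row_or_column_of_not_separatesAt [Nonempty ι] {f : (∀ i, π i) → (∀ k, ρ k) → M}
    (h : ∀ x x' y y', x ≠ x' → y ≠ y' → SeparatesAt f x y ∨ SeparatesAt f x' y') :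
    (∃ x, ∀ x' ≠ x, ∀ y, SeparatesAt f x' y) ∨ ∃ y, ∀ y' ≠ y, ∀ x, SeparatesAt f x y' := by
  by_cases hxy : ∃ x y, ¬ SeparatesAt f x y
  · obtain ⟨x, y, hxy⟩ := hxy
    by_cases hrow : ∃ y' ≠ y, ¬ SeparatesAt f x y'
    · obtain ⟨y', hy', hxy'⟩ := hrow
      refine .inl ⟨x, fun x'' hx'' y'' => ?_⟩
      obtain rfl | hy'' := eq_or_ne y y''
      · exact (h x x'' y' y hx''.symm hy').resolve_left hxy'
      · exact (h x x'' y y'' hx''.symm hy'').resolve_left hxy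
    · push Not at hrow
      refine .inr ⟨y, fun y' hy' x' => ?_⟩
      obtain rfl | hx' := eq_or_ne x x'
      · exact hrow y' hy'
      · exact (h x x' y y' hx' hy'.symm).resolve_left hxy
  · push Not at hxy
    exact .inl ⟨Classical.arbitrary ι, fun x' _ y => hxy x' y⟩

/-- Changing a coordinate `x' ≠ x` shifts `f` by an amount independent of `β`, so if a single
section `f · β` depends on `x'`, then every section ignores all the other coordinates. -/
lemma exists_dependsOn_left [Finite ι] [Finite κ]
    {f : (∀ i, π i) → (∀ k, ρ k) → M}
    (hf : ∀ β x x', x ≠ x' → DependsOn (f · β) {x}ᶜ ∨ DependsOn (f · β) {x'}ᶜ) {x : ι}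
    (hx : ∀ x' ≠ x, ∀ y, SeparatesAt f x' y) : ∃ x, ∀ β, DependsOn (f · β) {x} := by
  have hshift {x'} (hx' : x' ≠ x) (α a) (β β') :
      f (Function.update α x' a) β - f α β = f (Function.update α x' a) β' - f α β' := by
    have := Fintype.ofFinite κ
    exact dependsOn_compl_finset Finset.univ (fun y _ => hx x' hx' y α a) (by simp)
  have htransfer {x'} (hx' : x' ≠ x) {β} (h : DependsOn (f · β) {x'}ᶜ) (β') :
      DependsOn (f · β') {x'}ᶜ := by
    rw [dependsOn_compl_singleton_iff] at h ⊢
    intro α a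
    have := hshift hx' α a β β'
    rwa [h, sub_self, eq_comm, sub_eq_zero] at this
  by_cases hother : ∃ x' ≠ x, ∃ β, ¬ DependsOn (f · β) {x'}ᶜ
  · obtain ⟨x', hx', β₀, hβ₀⟩ := hother
    exact ⟨x', fun β => dependsOn_singleton fun x'' hx'' =>
      (hf β x' x'' hx''.symm).resolve_left fun h => hβ₀ (htransfer hx' h β₀)⟩
  · push Not at hother
    exact ⟨x, fun β => dependsOn_singleton fun x' hx' => hother x' hx' β⟩

theorem exists_dependsOn_left_or_right [Finite ι] [Nonempty ι] [Finite κ]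
    {f : (∀ i, π i) → (∀ k, ρ k) → M}
    (hleft : ∀ β x x', x ≠ x' → DependsOn (f · β) {x}ᶜ ∨ DependsOn (f · β) {x'}ᶜ)
    (hright : ∀ α y y', y ≠ y' → DependsOn (f α) {y}ᶜ ∨ DependsOn (f α) {y'}ᶜ)
    (hmixed : ∀ x x' y y', x ≠ x' → y ≠ y' → SeparatesAt f x y ∨ SeparatesAt f x' y') :
    (∃ x, ∀ β, DependsOn (f · β) {x}) ∨ ∃ y, ∀ α, DependsOn (f α) {y} := by
  classical
  obtain ⟨x, hx⟩ | ⟨y, hy⟩ := row_or_column_of_not_separatesAt hmixed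
  · exact .inl (exists_dependsOn_left hleft hx)
  · exact .inr (exists_dependsOn_left (f := flip f) hright fun y' hy' x => (hy y' hy' x).flip)

end DependsOn

section Strategies

variable {m : ℕ} {d : Fin m → ℕ}

/-- A deterministic strategy of one party: an output for each input. -/
abbrev LocalStrategy (d : Fin m → ℕ) : Type := ∀ x, Fin (d x)

/-- The probability (`0` or `1`) of the event `u` under the deterministic strategy `α`. -/
def response (α : LocalStrategy d) (u : LocalEvent d) : ℝ := if α u.1 = u.2 then 1 else 0

lemma response_self (α : LocalStrategy d) (x : Fin m) : response α ⟨x, α x⟩ = 1 := if_pos rfl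

lemma response_nonneg (α : LocalStrategy d) (u : LocalEvent d) : 0 ≤ response α u :=
  ite_nonneg zero_le_one le_rfl

lemma response_eq_zero_or_one (α : LocalStrategy d) (u : LocalEvent d) :
    response α u = 0 ∨ response α u = 1 :=
  (ite_eq_or_eq _ _ _).symm

lemma sum_response (α : LocalStrategy d) (x : Fin m) : ∑ a, response α ⟨x, a⟩ = 1 := by
  simp only [response, Finset.sum_ite_eq, Finset.mem_univ, if_true]

lemma response_update_of_ne (α : LocalStrategy d) {x : Fin m} (a : Fin (d x)) {u : LocalEvent d}
    (hu : u.1 ≠ x) : response (Function.update α x a) u = response α u := by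
  rw [response, response, Function.update_of_ne hu]

lemma response_update_self (α : LocalStrategy d) (x : Fin m) (a b : Fin (d x)) :
    response (Function.update α x a) ⟨x, b⟩ = if a = b then 1 else 0 := by
  rw [response, Function.update_self]

/-- Starting from the strategy `α₀`, one changes the answer to one input at a time; the increments
recover `p` since its total weight does not depend on the input. -/
lemma exists_sum_response_smul_of_sum_eq {M : Type*} [AddCommGroup M] [Module ℝ M]
    [Nonempty (Fin m)] (α₀ : LocalStrategy d) {p : LocalEvent d → M}
    (hp : ∀ x x', ∑ a, p ⟨x, a⟩ = ∑ a, p ⟨x', a⟩) :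
    ∃ q : LocalStrategy d → M, ∀ u, ∑ α, response α u • q α = p u := by
  let N := ∑ a, p ⟨Classical.arbitrary _, a⟩
  have hsingle (u : LocalEvent d) (α : LocalStrategy d) (n : M) :
      ∑ α', response α' u • (Pi.single α n : LocalStrategy d → M) α' = response α u • n := by
    rw [Fintype.sum_eq_single α fun α' h => by rw [Pi.single_eq_of_ne h, smul_zero],
      Pi.single_eq_same]
  have hsum (u : LocalEvent d) (α : LocalEvent d → LocalStrategy d) :
      ∑ α', response α' u • ∑ w, (Pi.single (α w) (p w) : LocalStrategy d → M) α' =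
        ∑ w, response (α w) u • p w := by
    simp only [Finset.smul_sum]
    rw [Finset.sum_comm]
    exact Finset.sum_congr rfl fun w _ => hsingle u (α w) (p w)
  refine ⟨Pi.single α₀ N + ∑ w : LocalEvent d,
    (Pi.single (Function.update α₀ w.1 w.2) (p w) - Pi.single α₀ (p w)), fun ⟨x, b⟩ => ?_⟩
  have hother (x') (hx' : x' ≠ x) : ∑ a, (response (Function.update α₀ x' a) ⟨x, b⟩ • p ⟨x', a⟩ -
      response α₀ ⟨x, b⟩ • p ⟨x', a⟩) = 0 :=
    Finset.sum_eq_zero fun a _ => by rw [response_update_of_ne α₀ a hx'.symm, sub_self]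
  calc _ = response α₀ ⟨x, b⟩ • N + ∑ w : LocalEvent d,
        (response (Function.update α₀ w.1 w.2) ⟨x, b⟩ • p w - response α₀ ⟨x, b⟩ • p w) := by
        simp only [Pi.add_apply, Finset.sum_apply, Pi.sub_apply, smul_add, smul_sub,
          Finset.sum_add_distrib, Finset.sum_sub_distrib, hsingle, hsum]
    _ = response α₀ ⟨x, b⟩ • N + ∑ a, (response (Function.update α₀ x a) ⟨x, b⟩ • p ⟨x, a⟩ -
          response α₀ ⟨x, b⟩ • p ⟨x, a⟩) := by
        rw [Fintype.sum_sigma, Fintype.sum_eq_single x hother]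
    _ = p ⟨x, b⟩ := by
        simp only [response_update_self, Finset.sum_sub_distrib, ite_smul, one_smul, zero_smul,
          Finset.sum_ite_eq', Finset.mem_univ, if_true, ← Finset.smul_sum]
        rw [hp x, add_sub_cancel]

/-- Signed weights on the events of one party whose total weight is the same for all inputs. -/
def constantSum (d : Fin m → ℕ) : Submodule ℝ (LocalEvent d → ℝ) where
  carrier := {p | ∀ x x', ∑ a, p ⟨x, a⟩ = ∑ a, p ⟨x', a⟩}
  add_mem' hp hq x x' := by
    simp only [Pi.add_apply, Finset.sum_add_distrib, hp x x', hq x x']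
  zero_mem' x x' := by simp only [Pi.zero_apply, Finset.sum_const_zero]
  smul_mem' r p hp x x' := by simp only [Pi.smul_apply, ← Finset.smul_sum, hp x x']

end Strategies

section Boxes

variable {mA mB : ℕ} {dA : Fin mA → ℕ} {dB : Fin mB → ℕ}

/-- A deterministic strategy of Alice together with one of Bob. -/
abbrev Strategy (dA : Fin mA → ℕ) (dB : Fin mB → ℕ) : Type :=
  LocalStrategy dA × LocalStrategy dB

/-- The box in which the two parties answer with the strategies `δ.1` and `δ.2`. -/
def deterministicBox (δ : Strategy dA dB) : Box dA dB :=
  fun e => response δ.1 e.1 * response δ.2 e.2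

/-- The combination of the deterministic boxes with weights `c`, which may be negative. -/
def signedMixture : (Strategy dA dB → ℝ) →ₗ[ℝ] Box dA dB :=
  Fintype.linearCombination ℝ deterministicBox

lemma signedMixture_apply (c : Strategy dA dB → ℝ) (e : BellEvent dA dB) :
    signedMixture c e = ∑ δ, c δ * deterministicBox δ e := by
  simp only [signedMixture, Fintype.linearCombination_apply, Finset.sum_apply, Pi.smul_apply,
    smul_eq_mul]

lemma signedMixture_single (δ : Strategy dA dB) :
    signedMixture (Pi.single δ 1) = deterministicBox δ := by
  rw [signedMixture, Fintype.linearCombination_apply_single, one_smul]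

lemma sum_left_signedMixture (c : Strategy dA dB → ℝ) (x : Fin mA) (v : LocalEvent dB) :
    ∑ a, signedMixture c (⟨x, a⟩, v) = ∑ δ, c δ * response δ.2 v := by
  simp only [signedMixture_apply, deterministicBox]
  rw [Finset.sum_comm]
  simp only [← Finset.mul_sum, ← Finset.sum_mul, sum_response, one_mul]

lemma sum_right_signedMixture (c : Strategy dA dB → ℝ) (u : LocalEvent dA) (y : Fin mB) :
    ∑ b, signedMixture c (u, ⟨y, b⟩) = ∑ δ, c δ * response δ.1 u := by
  simp only [signedMixture_apply, deterministicBox]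
  rw [Finset.sum_comm]
  simp only [← Finset.mul_sum, sum_response, mul_one]

lemma sum_signedMixture (c : Strategy dA dB → ℝ) (x : Fin mA) (y : Fin mB) :
    ∑ a, ∑ b, signedMixture c (⟨x, a⟩, ⟨y, b⟩) = ∑ δ, c δ := by
  simp only [sum_right_signedMixture]
  rw [Finset.sum_comm]
  simp only [← Finset.mul_sum, sum_response, mul_one]

lemma isNoSignalling_signedMixture {c : Strategy dA dB → ℝ} (hc : ∑ δ, c δ = 1)
    (hnonneg : ∀ e, 0 ≤ signedMixture c e) : IsNoSignalling (signedMixture c) where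
  nonneg := hnonneg
  normalized x y := by rw [sum_signedMixture, hc]
  noSignalling_to_Bob x x' y b := by rw [sum_left_signedMixture, sum_left_signedMixture]
  noSignalling_to_Alice y y' x a := by rw [sum_right_signedMixture, sum_right_signedMixture]

lemma isNoSignalling_deterministicBox (δ : Strategy dA dB) :
    IsNoSignalling (deterministicBox δ) := by
  rw [← signedMixture_single]
  refine isNoSignalling_signedMixture (by simp) fun e => ?_
  rw [signedMixture_single]
  exact mul_nonneg (response_nonneg _ _) (response_nonneg _ _)

lemma IsNoSignalling.swap {P : Box dA dB} (hP : IsNoSignalling P) :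
    IsNoSignalling (P ∘ Prod.swap : Box dB dA) where
  nonneg e := hP.nonneg e.swap
  normalized y x := Finset.sum_comm.trans (hP.normalized x y)
  noSignalling_to_Bob y y' x a := hP.noSignalling_to_Alice y y' x a
  noSignalling_to_Alice x x' y b := hP.noSignalling_to_Bob x x' y b

lemma IsNoSignalling.exists_ne_zero {P : Box dA dB} (hP : IsNoSignalling P) (x : Fin mA)
    (y : Fin mB) : ∃ a b, P (⟨x, a⟩, ⟨y, b⟩) ≠ 0 := by
  by_contra! h
  simpa only [h, Finset.sum_const_zero, zero_ne_one] using hP.normalized x y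

lemma IsNoSignalling.le_one {P : Box dA dB} (hP : IsNoSignalling P) (e : BellEvent dA dB) :
    P e ≤ 1 := by
  obtain ⟨⟨x, a⟩, ⟨y, b⟩⟩ := e
  rw [← hP.normalized x y]
  exact (Finset.single_le_sum (fun b _ => hP.nonneg (⟨x, a⟩, ⟨y, b⟩)) (Finset.mem_univ b)).trans
    (Finset.single_le_sum (fun a _ => Finset.sum_nonneg fun b _ => hP.nonneg (⟨x, a⟩, ⟨y, b⟩))
      (Finset.mem_univ a))

lemma IsNoSignalling.nonempty_strategy [Nonempty (Fin mA)] [Nonempty (Fin mB)] {P : Box dA dB}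
    (hP : IsNoSignalling P) : Nonempty (Strategy dA dB) :=
  ⟨fun x => (hP.exists_ne_zero x (Classical.arbitrary _)).choose,
    fun y => (hP.exists_ne_zero (Classical.arbitrary _) y).choose_spec.choose⟩

lemma IsNoSignalling.exists_signedMixture_eq [Nonempty (Fin mA)] [Nonempty (Fin mB)]
    {P : Box dA dB} (hP : IsNoSignalling P) : ∃ c, ∑ δ, c δ = 1 ∧ signedMixture c = P := by
  obtain ⟨α₀, β₀⟩ := hP.nonempty_strategy
  obtain ⟨q, hq⟩ := exists_sum_response_smul_of_sum_eq α₀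
    (p := fun u => (⟨fun v => P (u, v), fun y y' => hP.noSignalling_to_Alice y y' u.1 u.2⟩ :
      constantSum dB))
    fun x x' => Subtype.ext <| funext fun v => by
      simpa only [AddSubmonoidClass.coe_finsetSum, Finset.sum_apply] using
        hP.noSignalling_to_Bob x x' v.1 v.2
  choose c hc using fun α => exists_sum_response_smul_of_sum_eq β₀ (q α).2
  have hmix : signedMixture (fun δ => c δ.1 δ.2) = P := by
    ext ⟨u, v⟩
    have h := congrFun (congrArg Subtype.val (hq u)) v
    simp only [AddSubmonoidClass.coe_finsetSum, Finset.sum_apply, SetLike.val_smul, Pi.smul_apply,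
      ← hc, smul_eq_mul] at h
    simp only [← h, signedMixture_apply, Fintype.sum_prod_type, deterministicBox, Finset.mul_sum]
    exact Finset.sum_congr rfl fun α _ => Finset.sum_congr rfl fun β _ => by ring
  refine ⟨_, ?_, hmix⟩
  rw [← sum_signedMixture _ (Classical.arbitrary _) (Classical.arbitrary _), hmix, hP.normalized]

lemma IsNoSignalling.exists_le_response [Nonempty (Fin mB)] {P : Box dA dB}
    (hP : IsNoSignalling P) (h01 : ∀ e, P e = 0 ∨ P e = 1) :
    ∃ α : LocalStrategy dA, ∀ u v, P (u, v) ≤ response α u := by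
  have hex (x) : ∃ a b, P (⟨x, a⟩, ⟨Classical.arbitrary (Fin mB), b⟩) = 1 := by
    obtain ⟨a, b, hab⟩ := hP.exists_ne_zero x (Classical.arbitrary _)
    exact ⟨a, b, (h01 _).resolve_left hab⟩
  choose α b hα using hex
  refine ⟨α, fun ⟨x, a⟩ ⟨y, b'⟩ => ?_⟩
  have hle (a : Fin (dA x)) (y : Fin mB) (b : Fin (dB y)) :
      P (⟨x, a⟩, ⟨y, b⟩) ≤ ∑ b, P (⟨x, a⟩, ⟨y, b⟩) :=
    Finset.single_le_sum (fun b _ => hP.nonneg (⟨x, a⟩, ⟨y, b⟩)) (Finset.mem_univ b)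
  obtain rfl | ha := eq_or_ne a (α x)
  · rw [response_self]
    exact hP.le_one _
  have hpair : ∑ b, P (⟨x, a⟩, ⟨y, b⟩) + ∑ b, P (⟨x, α x⟩, ⟨y, b⟩) ≤
      ∑ a, ∑ b, P (⟨x, a⟩, ⟨y, b⟩) :=
    Finset.add_le_sum (fun a _ => Finset.sum_nonneg fun b _ => hP.nonneg (⟨x, a⟩, ⟨y, b⟩))
      (Finset.mem_univ a) (Finset.mem_univ (α x)) ha
  have hmarginal := hP.noSignalling_to_Alice y (Classical.arbitrary _) x (α x)
  rw [hP.normalized x y] at hpair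
  rw [response, if_neg ha.symm]
  linarith [hle a y b', hle (α x) _ (b x), hα x]

lemma IsNoSignalling.eq_of_le {P R : Box dA dB} (hP : IsNoSignalling P) (hR : IsNoSignalling R)
    (hle : ∀ e, P e ≤ R e) : P = R := by
  ext ⟨⟨x, a⟩, ⟨y, b⟩⟩
  have hsum : ∑ e : Fin (dA x) × Fin (dB y), P (⟨x, e.1⟩, ⟨y, e.2⟩) =
      ∑ e : Fin (dA x) × Fin (dB y), R (⟨x, e.1⟩, ⟨y, e.2⟩) := by
    rw [Fintype.sum_prod_type, Fintype.sum_prod_type, hP.normalized, hR.normalized]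
  exact (Finset.sum_eq_sum_iff_of_le fun e _ => hle (⟨x, e.1⟩, ⟨y, e.2⟩)).1 hsum (a, b)
    (Finset.mem_univ _)

lemma localDeterministicBoxes_eq_range [Nonempty (Fin mA)] [Nonempty (Fin mB)] :
    localDeterministicBoxes dA dB = Set.range deterministicBox := by
  refine Set.Subset.antisymm (fun P ⟨hP, h01⟩ => ?_) ?_
  · obtain ⟨α, hα⟩ := hP.exists_le_response h01
    obtain ⟨β, hβ⟩ := hP.swap.exists_le_response fun e => h01 e.swap
    refine ⟨(α, β), (hP.eq_of_le (isNoSignalling_deterministicBox _) fun ⟨u, v⟩ => ?_).symm⟩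
    have hu := hα u v
    have hv : P (u, v) ≤ response β v := hβ v u
    rcases response_eq_zero_or_one α u with h | h <;>
      simp only [deterministicBox, h, zero_mul, one_mul] at hu ⊢ <;> assumption
  · rintro _ ⟨δ, rfl⟩
    refine ⟨isNoSignalling_deterministicBox δ, fun e => ?_⟩
    rcases response_eq_zero_or_one δ.1 e.1 with h | h
    · exact .inl (by rw [deterministicBox, h, zero_mul])
    · rw [deterministicBox, h, one_mul]
      exact response_eq_zero_or_one δ.2 e.2

lemma deterministicBox_mem_classicalPolytope [Nonempty (Fin mA)] [Nonempty (Fin mB)]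
    (δ : Strategy dA dB) : deterministicBox δ ∈ classicalPolytope dA dB := by
  rw [classicalPolytope, localDeterministicBoxes_eq_range]
  exact subset_convexHull ℝ _ ⟨δ, rfl⟩

lemma classicalPolytope_eq_image [Nonempty (Fin mA)] [Nonempty (Fin mB)] :
    classicalPolytope dA dB = signedMixture '' stdSimplex ℝ (Strategy dA dB) := by
  rw [classicalPolytope, localDeterministicBoxes_eq_range,
    ← convexHull_rangle_single_eq_stdSimplex, LinearMap.image_convexHull, ← Set.range_comp]
  simp only [Function.comp_def, signedMixture_single]

lemma classicalPolytope_subset_noSignallingPolytope [Nonempty (Fin mA)] [Nonempty (Fin mB)] :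
    classicalPolytope dA dB ⊆ noSignallingPolytope dA dB := by
  rw [classicalPolytope_eq_image]
  rintro _ ⟨c, ⟨hc, hc1⟩, rfl⟩
  refine isNoSignalling_signedMixture hc1 fun e => ?_
  rw [signedMixture_apply]
  exact Finset.sum_nonneg fun δ _ =>
    mul_nonneg (hc δ) ((isNoSignalling_deterministicBox δ).nonneg e)

lemma affineSpan_noSignallingPolytope [Nonempty (Fin mA)] [Nonempty (Fin mB)] :
    affineSpan ℝ (noSignallingPolytope dA dB) = affineSpan ℝ (classicalPolytope dA dB) := by
  refine le_antisymm (affineSpan_le.2 fun P hP => ?_)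
    (affineSpan_mono ℝ classicalPolytope_subset_noSignallingPolytope)
  obtain ⟨c, hc1, rfl⟩ := IsNoSignalling.exists_signedMixture_eq hP
  rw [signedMixture, Fintype.linearCombination_apply,
    ← Finset.affineCombination_eq_linear_combination _ _ _ hc1, classicalPolytope,
    affineSpan_convexHull, localDeterministicBoxes_eq_range]
  exact affineCombination_mem_affineSpan hc1 _

end Boxes

section MomentMatrices

open Matrix

variable {mA mB : ℕ} {dA : Fin mA → ℕ} {dB : Fin mB → ℕ}

/-- Two events of one party are exclusive if they are different outputs of the same input. -/
def LocallyExclusive {m : ℕ} {d : Fin m → ℕ} (u v : LocalEvent d) : Prop :=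
  u.1 = v.1 ∧ u ≠ v

/-- Two events are exclusive if they are exclusive for one of the parties, that is, if the product
of the corresponding operators vanishes. -/
def Exclusive (e f : BellEvent dA dB) : Prop :=
  LocallyExclusive e.1 f.1 ∨ LocallyExclusive e.2 f.2

lemma LocallyExclusive.symm {m : ℕ} {d : Fin m → ℕ} {u v : LocalEvent d}
    (h : LocallyExclusive u v) : LocallyExclusive v u :=
  ⟨h.1.symm, h.2.symm⟩

lemma Exclusive.symm {e f : BellEvent dA dB} (h : Exclusive e f) : Exclusive f e :=
  h.imp LocallyExclusive.symm LocallyExclusive.symm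

lemma LocallyExclusive.response_mul {m : ℕ} {d : Fin m → ℕ} {u v : LocalEvent d}
    (h : LocallyExclusive u v) (α : LocalStrategy d) : response α u * response α v = 0 := by
  obtain ⟨x, a⟩ := u
  obtain ⟨x', b⟩ := v
  obtain ⟨rfl, hne⟩ : x = x' ∧ _ := h
  by_contra! hmul
  have ha := of_not_not fun h' => left_ne_zero_of_mul hmul (if_neg h')
  have hb := of_not_not fun h' => right_ne_zero_of_mul hmul (if_neg h')
  exact hne (by rw [← show α x = a from ha, ← show α x = b from hb])

lemma Exclusive.deterministicBox_mul {e f : BellEvent dA dB} (h : Exclusive e f)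
    (δ : Strategy dA dB) : deterministicBox δ e * deterministicBox δ f = 0 := by
  rw [deterministicBox, deterministicBox, mul_mul_mul_comm]
  rcases h with h | h
  · rw [h.response_mul, zero_mul]
  · rw [h.response_mul, mul_zero]

/-- The values of the operators of level `1 + AB` on the deterministic strategies. -/
def operatorValues (dA : Fin mA → ℕ) (dB : Fin mB → ℕ) :
    Matrix (Strategy dA dB) (OpIndex dA dB) ℝ :=
  of fun δ j => j.elim 1 (deterministicBox δ)

/-- The matrix of moments `∑ δ δ', Y δ δ' * Q(δ) * R(δ')` of the operators `Q` and `R`; for a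
diagonal `Y` these are the moments of a local hidden variable model. -/
def momentMatrix (Y : Matrix (Strategy dA dB) (Strategy dA dB) ℝ) :
    Matrix (OpIndex dA dB) (OpIndex dA dB) ℝ :=
  (operatorValues dA dB)ᵀ * Y * operatorValues dA dB

lemma vecMul_operatorValues_none (c : Strategy dA dB → ℝ) :
    (c ᵥ* operatorValues dA dB) none = ∑ δ, c δ := by
  simp only [vecMul, dotProduct, operatorValues, of_apply, Option.elim, mul_one]

lemma vecMul_operatorValues_some (c : Strategy dA dB → ℝ) (e : BellEvent dA dB) :
    (c ᵥ* operatorValues dA dB) (some e) = signedMixture c e :=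
  (signedMixture_apply c e).symm

lemma momentMatrix_transpose (Y : Matrix (Strategy dA dB) (Strategy dA dB) ℝ) :
    momentMatrix Yᵀ = (momentMatrix Y)ᵀ := by
  simp only [momentMatrix, transpose_mul, transpose_transpose, Matrix.mul_assoc]

lemma momentMatrix_vecMulVec (v w : Strategy dA dB → ℝ) :
    momentMatrix (vecMulVec v w) =
      vecMulVec (v ᵥ* operatorValues dA dB) (w ᵥ* operatorValues dA dB) := by
  rw [momentMatrix, mul_vecMulVec, vecMulVec_mul, mulVec_transpose]

lemma momentMatrix_apply (Y : Matrix (Strategy dA dB) (Strategy dA dB) ℝ) (j k : OpIndex dA dB) :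
    momentMatrix Y j k =
      ((Y *ᵥ fun δ => operatorValues dA dB δ k) ᵥ* operatorValues dA dB) j := by
  rw [momentMatrix, Matrix.mul_assoc, ← mulVec_transpose]
  rfl

lemma momentMatrix_none_none (Y : Matrix (Strategy dA dB) (Strategy dA dB) ℝ) :
    momentMatrix Y none none = ∑ δ, (Y *ᵥ 1) δ := by
  rw [momentMatrix_apply, vecMul_operatorValues_none]
  rfl

lemma momentMatrix_some_none (Y : Matrix (Strategy dA dB) (Strategy dA dB) ℝ)
    (e : BellEvent dA dB) : momentMatrix Y (some e) none = signedMixture (Y *ᵥ 1) e := by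
  rw [momentMatrix_apply, vecMul_operatorValues_some]
  rfl

lemma sum_momentMatrix_some (Y : Matrix (Strategy dA dB) (Strategy dA dB) ℝ)
    (j : OpIndex dA dB) (x : Fin mA) (y : Fin mB) :
    ∑ a, ∑ b, momentMatrix Y j (some (⟨x, a⟩, ⟨y, b⟩)) = momentMatrix Y j none := by
  simp only [← transpose_apply (momentMatrix Y), ← momentMatrix_transpose]
  simp only [momentMatrix_apply Yᵀ, vecMul_operatorValues_some, vecMul_operatorValues_none,
    sum_signedMixture]

/-- The coefficient matrices whose moments vanish on pairs of exclusive events. -/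
def orthogonalCoefficients (dA : Fin mA → ℕ) (dB : Fin mB → ℕ) :
    Submodule ℝ (Matrix (Strategy dA dB) (Strategy dA dB) ℝ) where
  carrier := {Y | ∀ e f, Exclusive e f → momentMatrix Y (some e) (some f) = 0}
  add_mem' hY hZ e f h := by
    rw [momentMatrix, Matrix.mul_add, Matrix.add_mul, Matrix.add_apply]
    exact (congrArg₂ _ (hY e f h) (hZ e f h)).trans (add_zero 0)
  zero_mem' e f _ := by rw [momentMatrix, Matrix.mul_zero, Matrix.zero_mul, Matrix.zero_apply]
  smul_mem' r Y hY e f h := by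
    rw [momentMatrix, Matrix.mul_smul, Matrix.smul_mul, Matrix.smul_apply]
    exact (congrArg _ (hY e f h)).trans (smul_zero r)

lemma one_mem_orthogonalCoefficients : 1 ∈ orthogonalCoefficients dA dB := fun e f h => by
  rw [momentMatrix, Matrix.mul_one, mul_apply]
  exact Finset.sum_eq_zero fun δ _ => h.deterministicBox_mul δ

lemma transpose_mem_orthogonalCoefficients {Y : Matrix (Strategy dA dB) (Strategy dA dB) ℝ}
    (hY : Y ∈ orthogonalCoefficients dA dB) : Yᵀ ∈ orthogonalCoefficients dA dB := fun e f h => by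
  rw [momentMatrix_transpose]
  exact hY f e h.symm

lemma vecMulVec_mem_orthogonalCoefficients {v w : Strategy dA dB → ℝ} :
    vecMulVec v w ∈ orthogonalCoefficients dA dB ↔
      ∀ e f, Exclusive e f → signedMixture v e * signedMixture w f = 0 := by
  simp only [← vecMul_operatorValues_some, ← vecMulVec_apply, ← momentMatrix_vecMulVec]
  rfl

/-- Summing over the outcomes turns the identity into projectors; only one of them survives the
product with `e`. -/
lemma momentMatrix_some_some_self {Y : Matrix (Strategy dA dB) (Strategy dA dB) ℝ}
    (hY : Y ∈ orthogonalCoefficients dA dB) (e : BellEvent dA dB) :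
    momentMatrix Y (some e) (some e) = momentMatrix Y (some e) none := by
  obtain ⟨⟨x, a⟩, ⟨y, b⟩⟩ := e
  rw [← sum_momentMatrix_some Y _ x y, Fintype.sum_eq_single a, Fintype.sum_eq_single b]
  · exact fun b' hb => hY _ _ (.inr ⟨rfl, by simpa using hb.symm⟩)
  · exact fun a' ha => Finset.sum_eq_zero fun b' _ => hY _ _ (.inl ⟨rfl, by simpa using ha.symm⟩)

lemma momentMatrix_none_some {Y : Matrix (Strategy dA dB) (Strategy dA dB) ℝ}
    (hY : Y ∈ orthogonalCoefficients dA dB) (e : BellEvent dA dB) :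
    momentMatrix Y none (some e) = momentMatrix Y (some e) (some e) := by
  have := momentMatrix_some_some_self (transpose_mem_orthogonalCoefficients hY) e
  rw [momentMatrix_transpose] at this
  exact this.symm

/-- The entry of `Γ` that corresponds to a reduced product `Q†R`, whose word begins with the
projectors of `Q` and ends with those of `R`. -/
def momentOfWord (Γ : Matrix (OpIndex dA dB) (OpIndex dA dB) ℝ) :
    Option (List (LocalEvent dA) × List (LocalEvent dB)) → ℝ
  | none => 0
  | some (l, l') => Γ (Option.map₂ Prod.mk l.head? l'.head?)
      (Option.map₂ Prod.mk l.getLast? l'.getLast?)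

lemma momentMatrix_eq_momentOfWord {Y : Matrix (Strategy dA dB) (Strategy dA dB) ℝ}
    (hY : Y ∈ orthogonalCoefficients dA dB) (Q R : OpIndex dA dB) :
    momentMatrix Y Q R = momentOfWord (momentMatrix Y) (daggerProduct Q R) := by
  rcases Q with _ | ⟨u, v⟩ <;> rcases R with _ | ⟨u', v'⟩
  · rfl
  · exact momentMatrix_none_some hY _
  · exact (momentMatrix_some_some_self hY _).symm
  · simp only [daggerProduct, Option.map_some, localProduct]
    split_ifs
    all_goals first
      | exact hY _ _ (.inl ⟨by assumption, by assumption⟩)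
      | exact hY _ _ (.inr ⟨by assumption, by assumption⟩)
      | subst_vars; rfl

lemma signedMixture_mulVec_one_mem_almostQuantumSet
    {Y : Matrix (Strategy dA dB) (Strategy dA dB) ℝ} (hY : Y ∈ orthogonalCoefficients dA dB)
    (hpos : Y.PosSemidef) (hone : ∑ δ, (Y *ᵥ 1) δ = 1) :
    signedMixture (Y *ᵥ 1) ∈ almostQuantumSet dA dB := by
  have hmoment : (momentMatrix Y).PosSemidef := hpos.conjTranspose_mul_mul_same _
  have hprob (e : BellEvent dA dB) :
      momentMatrix Y none (some e) = signedMixture (Y *ᵥ 1) e := by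
    rw [momentMatrix_none_some hY, momentMatrix_some_some_self hY, momentMatrix_some_none]
  refine ⟨isNoSignalling_signedMixture hone fun e => ?_,
    (momentMatrix Y).map (↑), posSemidef_map_ofReal hmoment, ?_, fun Q R S T h => ?_,
    fun Q R h => ?_, fun e => congrArg Complex.ofReal (hprob e)⟩
  · rw [← hprob, momentMatrix_none_some hY]
    exact hmoment.diag_nonneg
  · rw [map_apply, momentMatrix_none_none, hone, Complex.ofReal_one]
  · rw [map_apply, map_apply, momentMatrix_eq_momentOfWord hY, h, ← momentMatrix_eq_momentOfWord hY]
  · rw [map_apply, momentMatrix_eq_momentOfWord hY, h, momentOfWord, Complex.ofReal_zero]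

lemma vecMulVec_single_mem_orthogonalCoefficients (δ : Strategy dA dB) :
    vecMulVec (Pi.single δ 1) (Pi.single δ 1) ∈ orthogonalCoefficients dA dB :=
  vecMulVec_mem_orthogonalCoefficients.2 fun e f h => by
    rw [signedMixture_single, h.deterministicBox_mul δ]

lemma deterministicBox_mem_almostQuantumSet (δ : Strategy dA dB) :
    deterministicBox δ ∈ almostQuantumSet dA dB := by
  have hmulVec : vecMulVec (Pi.single δ 1) (Pi.single δ 1) *ᵥ 1 = (Pi.single δ 1 : _ → ℝ) := by
    rw [vecMulVec_mulVec, single_one_dotProduct, Pi.one_apply, MulOpposite.op_one, one_smul]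
  have hmem := signedMixture_mulVec_one_mem_almostQuantumSet
    (vecMulVec_single_mem_orthogonalCoefficients δ)
    (posSemidef_vecMulVec_self_star (Pi.single δ 1 : Strategy dA dB → ℝ))
    (by rw [hmulVec, Finset.sum_pi_single', if_pos (Finset.mem_univ δ)])
  rwa [hmulVec, signedMixture_single] at hmem

end MomentMatrices

section Facets

variable {mA mB : ℕ} {dA : Fin mA → ℕ} {dB : Fin mB → ℕ} {K L : Set (Box dA dB)} {B : Box dA dB}
  {ω : ℝ}

/-- The Bell expression with coefficients `B` as a linear functional of the box. -/
def bellFunctional (B : Box dA dB) : Box dA dB →ₗ[ℝ] ℝ where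
  toFun := bellValue B
  map_add' := dotProduct_add B
  map_smul' r := dotProduct_smul r B

lemma bellFunctional_apply (B P : Box dA dB) : bellFunctional B P = bellValue B P := rfl

lemma direction_face_le (K : Set (Box dA dB)) (B : Box dA dB) (ω : ℝ) :
    (affineSpan ℝ (face K B ω)).direction ≤
      (affineSpan ℝ K).direction ⊓ (bellFunctional B).ker := by
  refine le_inf (AffineSubspace.direction_le (affineSpan_mono ℝ fun P hP => hP.1)) ?_
  rw [direction_affineSpan, vectorSpan_def, Submodule.span_le]
  rintro _ ⟨P, hP, R, hR, rfl⟩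
  change bellFunctional B (P - R) = 0
  rw [map_sub, bellFunctional_apply, bellFunctional_apply, hP.2, hR.2, sub_self]

lemma SupportsFacet.exists_bellValue_ne (h : SupportsFacet K B ω) : ∃ P ∈ K, bellValue B P ≠ ω := by
  by_contra! hK
  exact h.proper (Set.Subset.antisymm (fun P hP => hP.1) fun P hP => ⟨hP, hK P hP⟩)

lemma SupportsFacet.direction_face (h : SupportsFacet K B ω) :
    (affineSpan ℝ (face K B ω)).direction =
      (affineSpan ℝ K).direction ⊓ (bellFunctional B).ker := by
  refine Submodule.eq_of_le_of_finrank_le (direction_face_le K B ω) ?_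
  obtain ⟨P, hP, hPω⟩ := h.nonempty
  obtain ⟨R, hR, hRω⟩ := h.exists_bellValue_ne
  have hlt : (affineSpan ℝ K).direction ⊓ (bellFunctional B).ker < (affineSpan ℝ K).direction := by
    refine inf_lt_left.2 fun hle => ?_
    have hdiff := hle (AffineSubspace.vsub_mem_direction (subset_affineSpan ℝ K hR)
      (subset_affineSpan ℝ K hP))
    rw [LinearMap.mem_ker, vsub_eq_sub, map_sub, bellFunctional_apply, bellFunctional_apply, hPω,
      sub_eq_zero] at hdiff
    exact hRω hdiff
  have hdim := h.dim
  have hfin := Submodule.finrank_lt_finrank_of_lt hlt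
  rw [affineDim, affineDim] at hdim
  omega

lemma SupportsFacet.mono (h : SupportsFacet K B ω) (hKL : K ⊆ L)
    (hspan : affineSpan ℝ K = affineSpan ℝ L) (hL : ∀ P ∈ L, bellValue B P ≤ ω) :
    SupportsFacet L B ω where
  valid := hL
  nonempty := h.nonempty.mono fun _ hP => ⟨hKL hP.1, hP.2⟩
  proper heq := by
    obtain ⟨P, hP, hPω⟩ := h.exists_bellValue_ne
    exact hPω (heq.symm.subset (hKL hP)).2
  dim := by
    have hdir : (affineSpan ℝ (face L B ω)).direction = (affineSpan ℝ (face K B ω)).direction := by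
      refine le_antisymm ?_ (AffineSubspace.direction_le
        (affineSpan_mono ℝ fun _ hP => ⟨hKL hP.1, hP.2⟩))
      rw [h.direction_face, hspan]
      exact direction_face_le L B ω
    rw [affineDim, affineDim, hdir, ← hspan]
    exact h.dim

lemma SupportsFacet.nonempty_bellEvent (h : SupportsFacet K B ω) : Nonempty (BellEvent dA dB) := by
  by_contra hempty
  rw [not_nonempty_iff] at hempty
  have hK : affineDim K = 0 := Module.finrank_zero_of_subsingleton
  have hdim := h.dim
  omega

end Facets

section Slack

open Matrix

variable {mA mB : ℕ} {dA : Fin mA → ℕ} {dB : Fin mB → ℕ} {B : Box dA dB} {ω : ℝ}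

/-- The amount by which a deterministic strategy fails to saturate the inequality `B · P ≤ ω`. -/
def slack (B : Box dA dB) (ω : ℝ) (δ : Strategy dA dB) : ℝ :=
  ω - bellValue B (deterministicBox δ)

lemma bellValue_signedMixture (B : Box dA dB) (c : Strategy dA dB → ℝ) :
    bellValue B (signedMixture c) = ∑ δ, c δ * bellValue B (deterministicBox δ) := by
  rw [← bellFunctional_apply, signedMixture, Fintype.linearCombination_apply, map_sum]
  simp only [map_smul, smul_eq_mul, bellFunctional_apply]

lemma dotProduct_slack (B : Box dA dB) (ω : ℝ) (c : Strategy dA dB → ℝ) :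
    c ⬝ᵥ slack B ω = ω * ∑ δ, c δ - bellValue B (signedMixture c) := by
  rw [mul_comm ω, Finset.sum_mul, bellValue_signedMixture]
  simp only [dotProduct, slack, mul_sub, Finset.sum_sub_distrib]

/-- The functional `Y ↦ ω * Γ 1 1 - ∑ e, B e * Γ e 1` of the moment matrix `Γ` of `Y`. -/
def slackFunctional (B : Box dA dB) (ω : ℝ) :
    Matrix (Strategy dA dB) (Strategy dA dB) ℝ →ₗ[ℝ] ℝ where
  toFun Y := (Y *ᵥ 1) ⬝ᵥ slack B ω
  map_add' Y Z := by rw [add_mulVec, add_dotProduct]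
  map_smul' r Y := by rw [smul_mulVec, smul_dotProduct, RingHom.id_apply]

lemma slackFunctional_apply (Y : Matrix (Strategy dA dB) (Strategy dA dB) ℝ) :
    slackFunctional B ω Y =
      ω * momentMatrix Y none none - bellValue B (fun e => momentMatrix Y (some e) none) := by
  simp only [momentMatrix_none_none, momentMatrix_some_none]
  exact dotProduct_slack B ω _

lemma slackFunctional_vecMulVec (v w : Strategy dA dB → ℝ) :
    slackFunctional B ω (vecMulVec v w) = (v ⬝ᵥ slack B ω) * ∑ δ, w δ := by
  change (vecMulVec v w *ᵥ 1) ⬝ᵥ slack B ω = _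
  rw [vecMulVec_mulVec, op_smul_eq_smul, smul_dotProduct, dotProduct_one, smul_eq_mul, mul_comm]

lemma slackFunctional_transpose {Y : Matrix (Strategy dA dB) (Strategy dA dB) ℝ}
    (hY : Y ∈ orthogonalCoefficients dA dB) :
    slackFunctional B ω Yᵀ = slackFunctional B ω Y := by
  simp only [slackFunctional_apply, momentMatrix_transpose, transpose_apply,
    momentMatrix_none_some hY, momentMatrix_some_some_self hY]

lemma slackFunctional_nonneg (hvalid : ∀ P ∈ almostQuantumSet dA dB, bellValue B P ≤ ω)
    {Y : Matrix (Strategy dA dB) (Strategy dA dB) ℝ} (hY : Y ∈ orthogonalCoefficients dA dB)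
    (hpos : Y.PosSemidef) : 0 ≤ slackFunctional B ω Y := by
  set t := ∑ δ, (Y *ᵥ 1) δ with ht
  rw [← one_dotProduct] at ht
  obtain ht0 | ht0 := (hpos.dotProduct_mulVec_nonneg 1).eq_or_lt
  · have hker := (hpos.dotProduct_mulVec_zero_iff 1).1 ht0.symm
    change 0 ≤ (Y *ᵥ 1) ⬝ᵥ slack B ω
    rw [hker, zero_dotProduct]
  · rw [star_trivial, ← ht] at ht0
    have hmem := signedMixture_mulVec_one_mem_almostQuantumSet
      (Submodule.smul_mem _ t⁻¹ hY) (hpos.smul (inv_nonneg.2 ht0.le))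
      (by rw [smul_mulVec, ← one_dotProduct, dotProduct_smul, ← ht, smul_eq_mul,
        inv_mul_cancel₀ ht0.ne'])
    have hval := hvalid _ hmem
    rw [smul_mulVec, map_smul, ← bellFunctional_apply, map_smul, bellFunctional_apply, smul_eq_mul,
      inv_mul_le_iff₀ ht0] at hval
    change 0 ≤ (Y *ᵥ 1) ⬝ᵥ slack B ω
    rw [dotProduct_slack]
    linarith

lemma exists_posSemidef_slack (hvalid : ∀ P ∈ almostQuantumSet dA dB, bellValue B P ≤ ω) :
    ∃ G : Matrix (Strategy dA dB) (Strategy dA dB) ℝ, G.PosSemidef ∧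
      ∀ v w, vecMulVec v w ∈ orthogonalCoefficients dA dB →
        v ⬝ᵥ G *ᵥ w = (v ⬝ᵥ slack B ω) * ∑ δ, w δ := by
  obtain ⟨G, hG, hval⟩ := exists_posSemidef_extension one_mem_orthogonalCoefficients
    (fun _ => transpose_mem_orthogonalCoefficients) (slackFunctional B ω)
    (fun _ => slackFunctional_transpose) (fun _ => slackFunctional_nonneg hvalid)
  exact ⟨G, hG, fun v w hvw => (hval v w hvw).trans (slackFunctional_vecMulVec v w)⟩

variable [Nonempty (Fin mA)] [Nonempty (Fin mB)]

lemma SupportsFacet.slack_nonneg (h : SupportsFacet (classicalPolytope dA dB) B ω)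
    (δ : Strategy dA dB) : 0 ≤ slack B ω δ :=
  sub_nonneg.2 (h.valid _ (deterministicBox_mem_classicalPolytope δ))

lemma SupportsFacet.slack_ne_zero (h : SupportsFacet (classicalPolytope dA dB) B ω) :
    slack B ω ≠ 0 := by
  intro hslack
  obtain ⟨P, hP, hPω⟩ := h.exists_bellValue_ne
  rw [classicalPolytope_eq_image] at hP
  obtain ⟨c, hc, rfl⟩ := hP
  have := dotProduct_slack B ω c
  rw [hslack, dotProduct_zero, hc.2, mul_one] at this
  exact hPω (by linarith)

lemma SupportsFacet.signedMixture_mem (h : SupportsFacet (classicalPolytope dA dB) B ω)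
    {W : Submodule ℝ (Box dA dB)} (hW : face (classicalPolytope dA dB) B ω ⊆ W)
    {v : Strategy dA dB → ℝ} (hv : v ⬝ᵥ slack B ω = 0) : signedMixture v ∈ W := by
  obtain ⟨P, hP⟩ := h.nonempty
  have hdir : (affineSpan ℝ (face (classicalPolytope dA dB) B ω)).direction ≤ W := by
    rw [direction_affineSpan, vectorSpan_def, Submodule.span_le]
    rintro _ ⟨R, hR, R', hR', rfl⟩
    exact W.sub_mem (hW hR) (hW hR')
  have hdiff : signedMixture v - (∑ δ, v δ) • P =
      ∑ δ, v δ • (deterministicBox δ - P) := by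
    rw [signedMixture, Fintype.linearCombination_apply, Finset.sum_smul, ← Finset.sum_sub_distrib]
    simp only [smul_sub]
  rw [← sub_add_cancel (signedMixture v) ((∑ δ, v δ) • P)]
  refine W.add_mem (hdir ?_) (W.smul_mem _ (hW hP))
  rw [h.direction_face]
  constructor
  · rw [hdiff]
    exact Submodule.sum_smul_mem _ _ fun δ _ => AffineSubspace.vsub_mem_direction
      (subset_affineSpan ℝ _ (deterministicBox_mem_classicalPolytope δ))
      (subset_affineSpan ℝ _ hP.1)
  · rw [dotProduct_slack, sub_eq_zero] at hv
    rw [SetLike.mem_coe, LinearMap.mem_ker, map_sub, map_smul, bellFunctional_apply,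
      bellFunctional_apply, hP.2, ← hv, smul_eq_mul, mul_comm, sub_self]

/-- A strategy that occurs in a saturating mixture has slack zero, so it lies in the kernel of `G`;
since the face spans the hyperplane of zero slack, so does that hyperplane. -/
lemma SupportsFacet.mulVec_eq_zero (h : SupportsFacet (classicalPolytope dA dB) B ω)
    {G : Matrix (Strategy dA dB) (Strategy dA dB) ℝ} (hG : G.PosSemidef)
    (hval : ∀ v w, vecMulVec v w ∈ orthogonalCoefficients dA dB →
      v ⬝ᵥ G *ᵥ w = (v ⬝ᵥ slack B ω) * ∑ δ, w δ)
    {v : Strategy dA dB → ℝ} (hv : v ⬝ᵥ slack B ω = 0) : G *ᵥ v = 0 := by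
  have hker {w} (hw : vecMulVec w w ∈ orthogonalCoefficients dA dB)
      (h0 : (w ⬝ᵥ slack B ω) * ∑ δ, w δ = 0) : G *ᵥ w = 0 :=
    (hG.dotProduct_mulVec_zero_iff w).1 ((hval w w hw).trans h0)
  have hface : face (classicalPolytope dA dB) B ω ⊆ G.mulVecLin.ker.map signedMixture := by
    rintro P ⟨hP, hPω⟩
    rw [classicalPolytope_eq_image] at hP
    obtain ⟨c, hc, rfl⟩ := hP
    refine ⟨c, ?_, rfl⟩
    have hsum : ∑ δ, c δ * slack B ω δ = 0 := by
      change c ⬝ᵥ slack B ω = 0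
      rw [dotProduct_slack, hc.2, hPω, mul_one, sub_self]
    rw [Finset.sum_eq_zero_iff_of_nonneg fun δ _ => mul_nonneg (hc.1 δ) (h.slack_nonneg δ)] at hsum
    rw [SetLike.mem_coe, LinearMap.mem_ker, pi_eq_sum_univ' c, map_sum]
    refine Finset.sum_eq_zero fun δ hδ => ?_
    rw [map_smul, smul_eq_zero]
    refine (mul_eq_zero.1 (hsum δ hδ)).imp_right fun hδ0 =>
      hker (vecMulVec_single_mem_orthogonalCoefficients δ) ?_
    rw [single_one_dotProduct, hδ0, zero_mul]
  obtain ⟨c, hc, hcv⟩ := h.signedMixture_mem hface hv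
  rw [← sub_eq_zero, ← map_sub] at hcv
  have hdiff : G *ᵥ (c - v) = 0 := by
    refine hker (vecMulVec_mem_orthogonalCoefficients.2 fun e f _ => ?_) ?_
    · rw [hcv, Pi.zero_apply, zero_mul]
    · rw [← sum_signedMixture _ (Classical.arbitrary _) (Classical.arbitrary _), hcv]
      simp only [Pi.zero_apply, Finset.sum_const_zero, mul_zero]
  rw [mulVec_sub, show G *ᵥ c = 0 from hc, zero_sub, neg_eq_zero] at hdiff
  exact hdiff

theorem SupportsFacet.dotProduct_slack_mul_dotProduct_slack
    (h : SupportsFacet (classicalPolytope dA dB) B ω)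
    (hvalid : ∀ P ∈ almostQuantumSet dA dB, bellValue B P ≤ ω) {v w : Strategy dA dB → ℝ}
    (hvw : ∀ e f, Exclusive e f → signedMixture v e * signedMixture w f = 0)
    (hw : ∑ δ, w δ = 0) : (v ⬝ᵥ slack B ω) * (w ⬝ᵥ slack B ω) = 0 := by
  obtain ⟨G, hG, hval⟩ := exists_posSemidef_slack hvalid
  obtain ⟨r, hr⟩ := exists_eq_smul_vecMulVec
    ((conjTranspose_eq_transpose_of_trivial G).symm.trans hG.isHermitian) h.slack_ne_zero
    fun u => h.mulVec_eq_zero hG hval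
  have hform (u u') : u ⬝ᵥ G *ᵥ u' = r * ((u ⬝ᵥ slack B ω) * (u' ⬝ᵥ slack B ω)) := by
    rw [hr, smul_mulVec, vecMulVec_mulVec, op_smul_eq_smul, dotProduct_smul, dotProduct_smul,
      smul_eq_mul, smul_eq_mul, dotProduct_comm _ u', mul_comm (u' ⬝ᵥ _)]
  have hr0 : r ≠ 0 := by
    obtain ⟨δ, hδ⟩ := Function.ne_iff.1 h.slack_ne_zero
    rintro rfl
    have := hval _ _ (vecMulVec_single_mem_orthogonalCoefficients δ)
    rw [hform, zero_mul, single_one_dotProduct, Finset.sum_pi_single', if_pos (Finset.mem_univ δ),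
      mul_one] at this
    exact hδ this.symm
  have hzero := hval v w (vecMulVec_mem_orthogonalCoefficients.2 hvw)
  rw [hform, hw, mul_zero] at hzero
  exact (mul_eq_zero.1 hzero).resolve_left hr0

end Slack

section ProductTests

open Matrix

section OneParty

variable {m : ℕ} {d : Fin m → ℕ}

/-- The signed weight that `v` gives to the event `u` of one party. -/
def eventWeight (v : LocalStrategy d → ℝ) (u : LocalEvent d) : ℝ := v ⬝ᵥ (response · u)

/-- Signed weights `v` and `w` on the strategies of one party such that the product of the weights
they give to two exclusive events is zero. -/
def LocallyOrthogonal (v w : LocalStrategy d → ℝ) : Prop :=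
  ∀ u u', LocallyExclusive u u' → eventWeight v u * eventWeight w u' = 0

/-- The difference of two deterministic strategies that differ in the answer to the input `x`. -/
def strategyDifference (α : LocalStrategy d) (x : Fin m) (a : Fin (d x)) : LocalStrategy d → ℝ :=
  Pi.single (Function.update α x a) 1 - Pi.single α 1

lemma strategyDifference_dotProduct (α : LocalStrategy d) (x : Fin m) (a : Fin (d x))
    (g : LocalStrategy d → ℝ) :
    strategyDifference α x a ⬝ᵥ g = g (Function.update α x a) - g α := by
  rw [strategyDifference, sub_dotProduct, single_one_dotProduct, single_one_dotProduct]

lemma sum_strategyDifference (α : LocalStrategy d) (x : Fin m) (a : Fin (d x)) :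
    ∑ α', strategyDifference α x a α' = 0 := by
  rw [← dotProduct_one, strategyDifference_dotProduct, Pi.one_apply, Pi.one_apply, sub_self]

lemma eventWeight_strategyDifference (α : LocalStrategy d) {x : Fin m} (a : Fin (d x))
    {u : LocalEvent d} (hu : u.1 ≠ x) : eventWeight (strategyDifference α x a) u = 0 := by
  rw [eventWeight, strategyDifference_dotProduct, response_update_of_ne α a hu, sub_self]

lemma locallyOrthogonal_single (α : LocalStrategy d) :
    LocallyOrthogonal (Pi.single α 1) (Pi.single α 1) := fun u u' h => by
  rw [eventWeight, eventWeight, single_one_dotProduct, single_one_dotProduct, h.response_mul]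

lemma locallyOrthogonal_strategyDifference {x x' : Fin m} (h : x ≠ x') (α α' : LocalStrategy d)
    (a : Fin (d x)) (a' : Fin (d x')) :
    LocallyOrthogonal (strategyDifference α x a) (strategyDifference α' x' a') := fun u u' hu => by
  obtain hx | rfl := ne_or_eq u.1 x
  · rw [eventWeight_strategyDifference α a hx, zero_mul]
  · rw [eventWeight_strategyDifference α' a' (hu.1 ▸ h), mul_zero]

lemma dependsOn_compl_iff_strategyDifference {x : Fin m} {g : LocalStrategy d → ℝ} :
    DependsOn g {x}ᶜ ↔ ∀ α a, strategyDifference α x a ⬝ᵥ g = 0 := by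
  simp only [dependsOn_compl_singleton_iff, strategyDifference_dotProduct, sub_eq_zero]

end OneParty

variable {mA mB : ℕ} {dA : Fin mA → ℕ} {dB : Fin mB → ℕ} {B : Box dA dB} {ω : ℝ}

/-- The weights on pairs of strategies in which the two parties are independent. -/
def productWeight (v : LocalStrategy dA → ℝ) (w : LocalStrategy dB → ℝ) : Strategy dA dB → ℝ :=
  fun δ => v δ.1 * w δ.2

lemma productWeight_dotProduct (v : LocalStrategy dA → ℝ) (w : LocalStrategy dB → ℝ)
    (s : Strategy dA dB → ℝ) :
    productWeight v w ⬝ᵥ s = v ⬝ᵥ fun α => w ⬝ᵥ Function.curry s α := by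
  simp only [productWeight, dotProduct, Fintype.sum_prod_type, Function.curry, mul_assoc,
    Finset.mul_sum]

lemma sum_productWeight (v : LocalStrategy dA → ℝ) (w : LocalStrategy dB → ℝ) :
    ∑ δ, productWeight v w δ = (∑ α, v α) * ∑ β, w β := by
  simp only [productWeight, Fintype.sum_mul_sum, Fintype.sum_prod_type]

lemma signedMixture_productWeight (v : LocalStrategy dA → ℝ) (w : LocalStrategy dB → ℝ)
    (e : BellEvent dA dB) :
    signedMixture (productWeight v w) e = eventWeight v e.1 * eventWeight w e.2 := by
  simp only [signedMixture_apply, productWeight, deterministicBox, eventWeight, dotProduct,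
    Fintype.sum_mul_sum, Fintype.sum_prod_type, mul_mul_mul_comm]

lemma separatesAt_iff_strategyDifference {f : LocalStrategy dA → LocalStrategy dB → ℝ} {x : Fin mA}
    {y : Fin mB} : SeparatesAt f x y ↔
      ∀ α a β b, strategyDifference α x a ⬝ᵥ (fun α => strategyDifference β y b ⬝ᵥ f α) = 0 := by
  simp only [SeparatesAt, dependsOn_compl_singleton_iff, strategyDifference_dotProduct, sub_eq_zero,
    sub_eq_sub_iff_sub_eq_sub]

lemma LocallyOrthogonal.signedMixture_mul {vA wA : LocalStrategy dA → ℝ}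
    {vB wB : LocalStrategy dB → ℝ} (hA : LocallyOrthogonal vA wA) (hB : LocallyOrthogonal vB wB)
    {e f : BellEvent dA dB} (h : Exclusive e f) :
    signedMixture (productWeight vA vB) e * signedMixture (productWeight wA wB) f = 0 := by
  rw [signedMixture_productWeight, signedMixture_productWeight, mul_mul_mul_comm]
  rcases h with h | h
  · rw [hA _ _ h, zero_mul]
  · rw [hB _ _ h, mul_zero]

variable [Nonempty (Fin mA)] [Nonempty (Fin mB)]

lemma SupportsFacet.dotProduct_slack_productWeight
    (h : SupportsFacet (classicalPolytope dA dB) B ω)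
    (hvalid : ∀ P ∈ almostQuantumSet dA dB, bellValue B P ≤ ω)
    {vA wA : LocalStrategy dA → ℝ} {vB wB : LocalStrategy dB → ℝ}
    (hA : LocallyOrthogonal vA wA) (hB : LocallyOrthogonal vB wB)
    (hsum : (∑ α, wA α) * ∑ β, wB β = 0) :
    vA ⬝ᵥ (fun α => vB ⬝ᵥ Function.curry (slack B ω) α) = 0 ∨
      wA ⬝ᵥ (fun α => wB ⬝ᵥ Function.curry (slack B ω) α) = 0 := by
  simp only [← productWeight_dotProduct, ← mul_eq_zero]
  exact h.dotProduct_slack_mul_dotProduct_slack hvalid (fun _ _ => hA.signedMixture_mul hB)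
    ((sum_productWeight wA wB).trans hsum)

lemma SupportsFacet.slack_dependsOn_compl_left (h : SupportsFacet (classicalPolytope dA dB) B ω)
    (hvalid : ∀ P ∈ almostQuantumSet dA dB, bellValue B P ≤ ω) (β : LocalStrategy dB)
    {x x' : Fin mA} (hx : x ≠ x') :
    DependsOn (Function.curry (slack B ω) · β) {x}ᶜ ∨
      DependsOn (Function.curry (slack B ω) · β) {x'}ᶜ := by
  simp only [dependsOn_compl_iff_strategyDifference]
  by_contra! hne
  obtain ⟨⟨α, a, hα⟩, α', a', hα'⟩ := hne
  have htest := h.dotProduct_slack_productWeight hvalid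
    (locallyOrthogonal_strategyDifference hx α α' a a') (locallyOrthogonal_single β)
    (by rw [sum_strategyDifference, zero_mul])
  simp only [single_one_dotProduct] at htest
  exact htest.elim hα hα'

lemma SupportsFacet.slack_dependsOn_compl_right (h : SupportsFacet (classicalPolytope dA dB) B ω)
    (hvalid : ∀ P ∈ almostQuantumSet dA dB, bellValue B P ≤ ω) (α : LocalStrategy dA)
    {y y' : Fin mB} (hy : y ≠ y') :
    DependsOn (Function.curry (slack B ω) α) {y}ᶜ ∨
      DependsOn (Function.curry (slack B ω) α) {y'}ᶜ := by
  simp only [dependsOn_compl_iff_strategyDifference]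
  by_contra! hne
  obtain ⟨⟨β, b, hβ⟩, β', b', hβ'⟩ := hne
  have htest := h.dotProduct_slack_productWeight hvalid (locallyOrthogonal_single α)
    (locallyOrthogonal_strategyDifference hy β β' b b')
    (by rw [sum_strategyDifference, mul_zero])
  simp only [single_one_dotProduct] at htest
  exact htest.elim hβ hβ'

lemma SupportsFacet.slack_separatesAt (h : SupportsFacet (classicalPolytope dA dB) B ω)
    (hvalid : ∀ P ∈ almostQuantumSet dA dB, bellValue B P ≤ ω)
    {x x' : Fin mA} {y y' : Fin mB} (hx : x ≠ x') (hy : y ≠ y') :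
    SeparatesAt (Function.curry (slack B ω)) x y ∨
      SeparatesAt (Function.curry (slack B ω)) x' y' := by
  simp only [separatesAt_iff_strategyDifference]
  by_contra! hne
  obtain ⟨⟨α, a, β, b, hαβ⟩, α', a', β', b', hαβ'⟩ := hne
  exact (h.dotProduct_slack_productWeight hvalid
    (locallyOrthogonal_strategyDifference hx α α' a a')
    (locallyOrthogonal_strategyDifference hy β β' b b')
    (by rw [sum_strategyDifference, zero_mul])).elim hαβ hαβ'

end ProductTests

section NonnegCombinations

open Matrix

lemma exists_sum_response_smul_of_dependsOn {M : Type*} [AddCommGroup M] [Module ℝ M] {m : ℕ}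
    {d : Fin m → ℕ} {g : LocalStrategy d → M} {x : Fin m} (hg : DependsOn g {x}) :
    ∃ S : LocalEvent d → M, (∀ u, S u ∈ insert 0 (Set.range g)) ∧
      ∀ α, g α = ∑ u, response α u • S u := by
  obtain _ | ⟨⟨α₀⟩⟩ := isEmpty_or_nonempty (LocalStrategy d)
  · exact ⟨0, fun u => .inl rfl, isEmptyElim⟩
  refine ⟨fun u => if u.1 = x then g (Function.update α₀ u.1 u.2) else 0, fun u => ?_, fun α => ?_⟩
  · beta_reduce
    split_ifs
    exacts [.inr ⟨_, rfl⟩, .inl rfl]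
  · beta_reduce
    rw [Fintype.sum_eq_single ⟨x, α x⟩, response_self, one_smul, if_pos rfl]
    · exact hg fun i hi => by rw [Set.mem_singleton_iff.1 hi, Function.update_self]
    · rintro ⟨x', a⟩ hne
      by_cases hx : x' = x
      · subst hx
        rw [response, if_neg fun ha => hne (Sigma.ext rfl (heq_of_eq ha.symm)), zero_smul]
      · rw [if_neg hx, smul_zero]

variable {mA mB : ℕ} {dA : Fin mA → ℕ} {dB : Fin mB → ℕ} {B : Box dA dB} {ω : ℝ}

lemma exists_nonneg_bellValue_eq {f : LocalStrategy dA → LocalStrategy dB → ℝ}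
    (hf : 0 ≤ f) {x : Fin mA} (hx : DependsOn f {x}) (hy : ∀ α, ∃ y, DependsOn (f α) {y}) :
    ∃ k : Box dA dB, 0 ≤ k ∧ ∀ α β, f α β = bellValue k (deterministicBox (α, β)) := by
  obtain ⟨S, hS, hfS⟩ := exists_sum_response_smul_of_dependsOn hx
  have hrow (u : LocalEvent dA) : ∃ T : LocalEvent dB → ℝ, 0 ≤ T ∧
      ∀ β, S u β = ∑ v, response β v * T v := by
    obtain h0 | ⟨α, hα⟩ := hS u
    · exact ⟨0, le_rfl, fun β => by simp only [h0, Pi.zero_apply, mul_zero, Finset.sum_const_zero]⟩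
    · obtain ⟨y, hy⟩ := hy α
      obtain ⟨T, hT, hαT⟩ := exists_sum_response_smul_of_dependsOn hy
      refine ⟨T, fun v => ?_, by simpa only [← hα, smul_eq_mul] using hαT⟩
      obtain h0 | ⟨β, hβ⟩ := hT v
      · exact h0.ge
      · exact (hf α β).trans_eq hβ
  choose T hT hST using hrow
  refine ⟨fun e => T e.1 e.2, fun e => hT e.1 e.2, fun α β => ?_⟩
  simp only [hfS α, Finset.sum_apply, Pi.smul_apply, hST, smul_eq_mul, Finset.mul_sum, bellValue,
    Fintype.sum_prod_type, deterministicBox, ← mul_assoc, mul_comm (T _ _)]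

lemma bellValue_deterministicBox_swap (B : Box dA dB) (δ : Strategy dB dA) :
    bellValue (B ∘ Prod.swap) (deterministicBox δ) = bellValue B (deterministicBox δ.swap) :=
  Fintype.sum_equiv (Equiv.prodComm _ _) _ _ fun e =>
    congrArg (B e.swap * ·) (mul_comm (response δ.1 e.1) (response δ.2 e.2))

variable [Nonempty (Fin mA)] [Nonempty (Fin mB)]

lemma SupportsFacet.exists_nonneg_slack_eq (h : SupportsFacet (classicalPolytope dA dB) B ω)
    (hvalid : ∀ P ∈ almostQuantumSet dA dB, bellValue B P ≤ ω) :
    ∃ k : Box dA dB, 0 ≤ k ∧ ∀ δ, slack B ω δ = bellValue k (deterministicBox δ) := by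
  have hleft (β) := exists_dependsOn_singleton fun x x' => h.slack_dependsOn_compl_left hvalid β
  have hright (α) := exists_dependsOn_singleton fun y y' => h.slack_dependsOn_compl_right hvalid α
  obtain ⟨x, hx⟩ | ⟨y, hy⟩ := exists_dependsOn_left_or_right
    (fun β x x' => h.slack_dependsOn_compl_left hvalid β)
    (fun α y y' => h.slack_dependsOn_compl_right hvalid α)
    (fun x x' y y' => h.slack_separatesAt hvalid)
  · obtain ⟨k, hk, hslack⟩ := exists_nonneg_bellValue_eq (fun α β => h.slack_nonneg (α, β))
      (fun α α' hα => funext fun β => hx β hα) hright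
    exact ⟨k, hk, fun δ => hslack δ.1 δ.2⟩
  · obtain ⟨k, hk, hslack⟩ := exists_nonneg_bellValue_eq
      (f := flip (Function.curry (slack B ω))) (fun β α => h.slack_nonneg (α, β))
      (fun β β' hβ => funext fun α => hy α hβ) hleft
    exact ⟨k ∘ Prod.swap, fun e => hk e.swap, fun δ =>
      (hslack δ.2 δ.1).trans (bellValue_deterministicBox_swap k δ).symm⟩

lemma bellValue_le_of_nonneg_slack_eq {k : Box dA dB} (hk : 0 ≤ k)
    (hslack : ∀ δ, slack B ω δ = bellValue k (deterministicBox δ)) {P : Box dA dB}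
    (hP : P ∈ noSignallingPolytope dA dB) : bellValue B P ≤ ω := by
  obtain ⟨c, hc, rfl⟩ := IsNoSignalling.exists_signedMixture_eq hP
  have hgap : ω - bellValue B (signedMixture c) = bellValue k (signedMixture c) := by
    calc ω - bellValue B (signedMixture c) = c ⬝ᵥ slack B ω := by
          rw [dotProduct_slack, hc, mul_one]
      _ = bellValue k (signedMixture c) := by
          rw [bellValue_signedMixture]
          exact Finset.sum_congr rfl fun δ _ => by rw [hslack]
  rw [← sub_nonneg, hgap]
  exact Finset.sum_nonneg fun e _ => mul_nonneg (hk e) (hP.nonneg e)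

end NonnegCombinations

section AlmostQuantumViolation

variable {mA mB : ℕ} {dA : Fin mA → ℕ} {dB : Fin mB → ℕ} {B : Box dA dB} {ω : ℝ}

theorem SupportsFacet.noSignallingPolytope_of_almostQuantumSet
    [Nonempty (Fin mA)] [Nonempty (Fin mB)]
    (h : SupportsFacet (classicalPolytope dA dB) B ω)
    (hvalid : ∀ P ∈ almostQuantumSet dA dB, bellValue B P ≤ ω) :
    SupportsFacet (noSignallingPolytope dA dB) B ω := by
  obtain ⟨k, hk, hslack⟩ := h.exists_nonneg_slack_eq hvalid
  exact h.mono classicalPolytope_subset_noSignallingPolytope affineSpan_noSignallingPolytope.symm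
    fun P => bellValue_le_of_nonneg_slack_eq hk hslack

lemma SupportsFacet.isGreatest {K : Set (Box dA dB)} (h : SupportsFacet K B ω) :
    IsGreatest (bellValue B '' K) ω := by
  obtain ⟨P, hP, hPω⟩ := h.nonempty
  exact ⟨⟨P, hP, hPω⟩, Set.forall_mem_image.2 h.valid⟩

lemma bddAbove_bellValue_almostQuantumSet (B : Box dA dB) :
    BddAbove (bellValue B '' almostQuantumSet dA dB) := by
  refine ⟨∑ e, |B e|, ?_⟩
  rintro _ ⟨P, hP, rfl⟩
  refine Finset.sum_le_sum fun e _ => (le_abs_self _).trans ?_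
  rw [abs_mul, abs_of_nonneg (hP.1.nonneg e)]
  exact mul_le_of_le_one_right (abs_nonneg _) (hP.1.le_one e)

end AlmostQuantumViolation

theorem mainTheorem1 (mA mB : ℕ) (dA : Fin mA → ℕ) (dB : Fin mB → ℕ)
    (q : Fin mA → Fin mB → ℝ) (V : BellEvent dA dB → ℝ) (B : Box dA dB)
    (hB : ∀ e, B e = q e.1.1 e.2.1 * V e) (ωc : ℝ)
    (hfacet : IsFacetBellInequality B ωc) :
    IsGreatest (bellValue B '' classicalPolytope dA dB) ωc ∧
      ωc = classicalValue B ∧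
      IsLUB (bellValue B '' almostQuantumSet dA dB) (almostQuantumValue B) ∧
      ωc < almostQuantumValue B := by
  obtain ⟨e⟩ := hfacet.facet.nonempty_bellEvent
  have : Nonempty (Fin mA) := ⟨e.1.1⟩
  have : Nonempty (Fin mB) := ⟨e.2.1⟩
  obtain ⟨δ, -⟩ := Function.ne_iff.1 hfacet.facet.slack_ne_zero
  have hlub : IsLUB (bellValue B '' almostQuantumSet dA dB) (almostQuantumValue B) :=
    isLUB_csSup ⟨_, deterministicBox δ, deterministicBox_mem_almostQuantumSet δ, rfl⟩
      (bddAbove_bellValue_almostQuantumSet B)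
  refine ⟨hfacet.facet.isGreatest, hfacet.facet.isGreatest.csSup_eq.symm, hlub, ?_⟩
  by_contra! hle
  exact hfacet.nontrivial <| hfacet.facet.noSignallingPolytope_of_almostQuantumSet fun P hP =>
    (hlub.1 ⟨P, hP, rfl⟩).trans hle
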